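/- Let $p$ be a prime and let $G$ be a $p$-group of maximal class of order $p^n$ (that is, $|G|=p^n$ with $n\ge 2$ and $G$ has nilpotency class $n-1$), where $n\ge p+1$, and suppose that $G$ has an abelian maximal subgroup. Put $G_1=C_G(\gamma_2(G)/\gamma_4(G))$, where $\gamma_i(G)$ denotes the $i$-th term of the lower central series of $G$ (with $\gamma_1(G)=G$). Then $G$ is a Beauville group if and only if $p\ge 5$ and every element of $G\smallsetminus G_1$ has order $p$. Moreover, every such Beauville group $G$ is of tame type. Here, for elements $x,y$ of a group $H$, let $\Sigma(\{x,y\})$ be the union of all the conjugates $\langle t\rangle^h$ with $t\in\{x,y,xy\}$ and $h\in H$; two $2$-element generating sets $S_1,S_2$ of $H$ form a Beauville structure of $H$ if $\Sigma(S_1)\cap\Sigma(S_2)=\{1\}$. A finite group is a Beauville group if it has a Beauville structure. A Beauville $p$-group $G$ is of tame type if every lift to $G$ of a Beauville structure of $G/\Phi(G)$ is a Beauville structure of $G$, where $\Phi(G)$ is the Frattini subgroup. -/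

import Mathlib

namespace Beauville

section Structures

variable {G : Type*} [Group G]

/-- The set `Σ(S)` for `S = {x, y}`: the union of all conjugates `⟨t⟩ ^ g` of the cyclic
subgroups generated by the members `t` of the triple `T = {x, y, xy}`. -/
def sigmaSet (x y : G) : Set G :=
  ⋃ t ∈ ({x, y, x * y} : Set G), ⋃ g : G, {z | ∃ c ∈ Subgroup.zpowers t, z = g⁻¹ * c * g}

/-- `Σ` does not depend on the order in which the two members of `S` are listed. -/
theorem sigmaSet_comm (x y : G) : sigmaSet x y = sigmaSet y x := by
  have key : ∀ a b : G, sigmaSet a b ⊆ sigmaSet b a := by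
    intro a b z hz
    simp only [sigmaSet, Set.mem_iUnion, Set.mem_insert_iff, Set.mem_singleton_iff,
      Set.mem_ofPred_eq, exists_prop] at hz ⊢
    obtain ⟨t, ht, g, c, hc, rfl⟩ := hz
    rcases ht with rfl | rfl | rfl
    · exact ⟨_, Or.inr (Or.inl rfl), g, c, hc, rfl⟩
    · exact ⟨_, Or.inl rfl, g, c, hc, rfl⟩
    · obtain ⟨k, rfl⟩ := hc
      refine ⟨b * a, Or.inr (Or.inr rfl), a⁻¹ * g, (b * a) ^ k, ⟨k, rfl⟩, ?_⟩
      have h : a * b = a * (b * a) * a⁻¹ := by group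
      have h2 : (a * b) ^ k = a * (b * a) ^ k * a⁻¹ := by rw [h, conj_zpow]
      simp only [h2]
      group
  exact Set.Subset.antisymm (key x y) (key y x)

/-- The sets `S₁ = {x₁, y₁}` and `S₂ = {x₂, y₂}` form a Beauville structure: both consist of two
distinct elements, both generate `G`, and `Σ(S₁) ∩ Σ(S₂) = 1`. -/
structure IsBeauvilleStructure (x₁ y₁ x₂ y₂ : G) : Prop where
  ne₁ : x₁ ≠ y₁
  ne₂ : x₂ ≠ y₂
  gen₁ : Subgroup.closure {x₁, y₁} = ⊤
  gen₂ : Subgroup.closure {x₂, y₂} = ⊤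
  inter : sigmaSet x₁ y₁ ∩ sigmaSet x₂ y₂ = {1}

end Structures

/-- Beauville groups: finite groups (necessarily generated by two elements) with a
Beauville structure. -/
def IsBeauville (G : Type*) [Group G] : Prop :=
  Finite G ∧ ∃ x₁ y₁ x₂ y₂ : G, IsBeauvilleStructure x₁ y₁ x₂ y₂

/-- Tame type: `G` is a Beauville group, and every lift to `G` of a Beauville structure of
`G / Φ(G)` is a Beauville structure of `G`. -/
def IsTameType (G : Type*) [Group G] : Prop :=
  IsBeauville G ∧ ∀ x₁ y₁ x₂ y₂ : G,
    IsBeauvilleStructure (x₁ : G ⧸ frattini G) (y₁ : G ⧸ frattini G)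
      (x₂ : G ⧸ frattini G) (y₂ : G ⧸ frattini G) →
    IsBeauvilleStructure x₁ y₁ x₂ y₂

/-- `G` is a `p`-group of maximal class of order `p ^ n`: `n ≥ 2` and `G` has nilpotency class
`n - 1` (for `p` a prime). -/
structure IsMaximalClass (p n : ℕ) (G : Type*) [Group G] : Prop where
  two_le : 2 ≤ n
  card_eq : Nat.card G = p ^ n
  nilpotent : Group.IsNilpotent G
  class_eq : Group.nilpotencyClass G + 1 = n

/-- `γ_i(G)` for `i ≥ 1`, with the usual numbering `γ_1(G) = G`, `γ_2(G) = G'`. -/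
abbrev gam (G : Type*) [Group G] (i : ℕ) : Subgroup G :=
  (⊤ : Subgroup G).lowerCentralSeries (i - 1)

/-- `G_1 = C_G(γ_2(G) / γ_4(G))`, the elements of `G` whose image in `G / γ_4(G)` centralizes
the image of `γ_2(G)`. -/
def G₁ (G : Type*) [Group G] : Subgroup G :=
  (Subgroup.centralizer
    ((gam G 2).map (QuotientGroup.mk' (gam G 4)) : Set (G ⧸ gam G 4))).comap
      (QuotientGroup.mk' (gam G 4))

open scoped commutatorElement in
theorem mem_G₁_iff {G : Type*} [Group G] (g : G) :
    g ∈ G₁ G ↔ ∀ h ∈ gam G 2, ⁅h, g⁆ ∈ gam G 4 := by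
  simp only [G₁, Subgroup.mem_comap, Subgroup.mem_centralizer_iff, Subgroup.coe_map,
    Set.forall_mem_image, SetLike.mem_coe]
  refine forall₂_congr fun h _ => ?_
  rw [← QuotientGroup.eq_one_iff, ← QuotientGroup.mk'_apply, map_commutatorElement,
    commutatorElement_eq_one_iff_mul_comm]

end Beauville

namespace Beauville

/-! ### Maximal subgroups and the Frattini quotient of a finite `p`-group. -/

section PGroups

variable {p : ℕ} {G : Type*} [Group G]

/-! Let M be the abelian maximal subgroup. For t outside M, commutation with t is a homomorphism on
M with image G' = Φ(G) and kernel Z(G) ∩ M, of order p (`range_commutatorHom`,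
`IsMaximalClass.card_center_inf`). So the coset tG' consists of conjugates of t, and t^p, which lies
in Z(G) ∩ M, is trivial or generates it. Moreover m ↦ r^{-p}(rm)^p is a homomorphism on M for r
outside M, so two elements of order p outside M, independent modulo Φ(G), force every element
outside M to have order p (`IsMaximalClass.pow_eq_one_of_coordDet_ne_zero`).

Every generating triple has two members outside M, independent modulo Φ(G). If some element outside
M had nontrivial p-th power, each triple of a Beauville structure would have a member whose powers
contain Z(G) ∩ M, a contradiction. If p ≤ 3, the plane G/Φ(G) has at most four lines, so the triples
share a line spanned by an element outside M, and conjugacy of cosets makes the sets Σ meet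
nontrivially.

Conversely, once elements outside M have order p, triples spanning six distinct lines of G/Φ(G) give
a Beauville structure (`isBeauvilleStructure_of_coordDet_ne_zero`): two independent elements are not
both in M, and the one outside M has no nontrivial power conjugate to a power of the other. Six
lines exist for p ≥ 5, and the same criterion gives tameness. Finally G₁ = M once n ≥ 4. -/

theorem normal_of_isCoatom [Fact p.Prime] [Finite G] (hG : IsPGroup p G) {H : Subgroup G}
    (hH : IsCoatom H) : H.Normal :=
  have := hG.isNilpotent
  Subgroup.NormalizerCondition.normal_of_coatom H Group.normalizerCondition_of_isNilpotent hH

theorem index_of_isCoatom [Fact p.Prime] [Finite G] (hG : IsPGroup p G) {H : Subgroup G}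
    (hH : IsCoatom H) : H.index = p := by
  have := normal_of_isCoatom hG hH
  have hq : IsPGroup p (G ⧸ H) := hG.to_quotient H
  have hne : Nat.card (G ⧸ H) ≠ 1 := by
    intro h
    exact hH.1 (Subgroup.index_eq_one.mp h)
  have hdvd : p ∣ Nat.card (G ⧸ H) := hq.card_eq_or_dvd.resolve_left hne
  obtain ⟨x, hx⟩ := exists_prime_orderOf_dvd_card' p hdvd
  have hlt : H < (Subgroup.zpowers x).comap (QuotientGroup.mk' H) := by
    refine lt_of_le_of_ne ?_ ?_
    · intro h hh
      have : (QuotientGroup.mk' H) h = 1 := (QuotientGroup.eq_one_iff h).mpr hh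
      rw [Subgroup.mem_comap, this]
      exact one_mem _
    · intro heq
      obtain ⟨g, rfl⟩ := QuotientGroup.mk'_surjective H x
      have hg : g ∈ H := by
        rw [heq]
        exact Subgroup.mem_zpowers _
      have : (QuotientGroup.mk' H) g = 1 := (QuotientGroup.eq_one_iff g).mpr hg
      rw [this, orderOf_one] at hx
      exact (Fact.out : p.Prime).one_lt.ne hx
  have htop := hH.2 _ hlt
  have hz : Subgroup.zpowers x = ⊤ := by
    rw [eq_top_iff]
    intro y _
    obtain ⟨g, rfl⟩ := QuotientGroup.mk'_surjective H y
    have : g ∈ (Subgroup.zpowers x).comap (QuotientGroup.mk' H) := htop ▸ Subgroup.mem_top g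
    exact this
  rw [Subgroup.index_eq_card, ← Subgroup.card_top, ← hz, Nat.card_zpowers, hx]

theorem commutator_le_of_isCoatom [Fact p.Prime] [Finite G] (hG : IsPGroup p G)
    {H : Subgroup G} (hH : IsCoatom H) : commutator G ≤ H := by
  have := normal_of_isCoatom hG hH
  have hc : Nat.card (G ⧸ H) = p := index_of_isCoatom hG hH
  have : IsCyclic (G ⧸ H) := isCyclic_of_prime_card hc
  refine (Subgroup.Normal.quotient_commutative_iff_commutator_le).mp ?_
  exact IsCyclic.isMulCommutative

theorem pow_mem_of_isCoatom [Fact p.Prime] [Finite G] (hG : IsPGroup p G)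
    {H : Subgroup G} (hH : IsCoatom H) (g : G) : g ^ p ∈ H := by
  have := normal_of_isCoatom hG hH
  rw [← index_of_isCoatom hG hH]
  exact Subgroup.pow_index_mem H g

theorem commutator_le_frattini [Fact p.Prime] [Finite G] (hG : IsPGroup p G) :
    commutator G ≤ frattini G := by
  simp only [frattini, Order.radical, le_iInf_iff]
  intro H hH
  exact commutator_le_of_isCoatom hG hH

theorem pow_mem_frattini [Fact p.Prime] [Finite G] (hG : IsPGroup p G) (g : G) :
    g ^ p ∈ frattini G := by
  simp only [frattini, Order.radical, Subgroup.mem_iInf]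
  intro H hH
  exact pow_mem_of_isCoatom hG hH g

/-- Finite groups are generated by any subset that generates modulo the Frattini subgroup. -/
theorem eq_top_of_map_frattini_eq_top [Finite G] {K : Subgroup G}
    (h : K.map (QuotientGroup.mk' (frattini G)) = ⊤) : K = ⊤ := by
  refine frattini_nongenerating ?_
  rw [← QuotientGroup.ker_mk' (frattini G), ← Subgroup.comap_map_eq, h, Subgroup.comap_top]

theorem exists_mulEquiv_zmod_prod [Fact p.Prime] {A : Type*} [CommGroup A]
    (hpow : ∀ a : A, a ^ p = 1) (hcard : Nat.card A = p ^ 2) :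
    Nonempty (A ≃* Multiplicative (ZMod p × ZMod p)) := by
  let : Module (ZMod p) (Additive A) := AddCommGroup.zmodModule (n := p) (G := Additive A) hpow
  have hp : p.Prime := Fact.out
  have : Finite A := Nat.finite_of_card_ne_zero (hcard ▸ pow_ne_zero 2 hp.ne_zero)
  have hmf : Module.Finite (ZMod p) (Additive A) :=
    Module.Finite.of_finite
  have hfin : Module.finrank (ZMod p) (Additive A) = 2 := by
    have h := Module.natCard_eq_pow_finrank (K := ZMod p) (V := Additive A)
    rw [Nat.card_zmod, show Nat.card (Additive A) = p ^ 2 from hcard] at h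
    exact (Nat.pow_right_injective hp.two_le h).symm
  let e : Additive A ≃ₗ[ZMod p] (ZMod p × ZMod p) :=
    LinearEquiv.ofFinrankEq _ _ (by rw [hfin]; simp)
  exact ⟨AddEquiv.toMultiplicativeRight e.toAddEquiv⟩

/-- Coordinates on the Frattini quotient of a finite `p`-group of rank two. -/
theorem exists_frattini_coordinates [Fact p.Prime] [Finite G] (hG : IsPGroup p G)
    (hcard : Nat.card (G ⧸ frattini G) = p ^ 2) :
    ∃ π : G →* Multiplicative (ZMod p × ZMod p),
      Function.Surjective π ∧ π.ker = frattini G := by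
  have hcomm : ∀ a b : G ⧸ frattini G, a * b = b * a :=
    ((Subgroup.Normal.quotient_commutative_iff_commutator_le).mpr
      (commutator_le_frattini hG)).is_comm.comm
  let : CommGroup (G ⧸ frattini G) := { (inferInstance : Group (G ⧸ frattini G)) with
    mul_comm := hcomm }
  have hpow : ∀ x : G ⧸ frattini G, x ^ p = 1 := by
    intro x
    obtain ⟨g, rfl⟩ := QuotientGroup.mk'_surjective (frattini G) x
    rw [← map_pow]
    exact (QuotientGroup.eq_one_iff _).mpr (pow_mem_frattini hG g)
  obtain ⟨e⟩ := exists_mulEquiv_zmod_prod hpow hcard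
  refine ⟨e.toMonoidHom.comp (QuotientGroup.mk' (frattini G)), ?_, ?_⟩
  · exact e.surjective.comp (QuotientGroup.mk'_surjective _)
  · ext g
    rw [MonoidHom.mem_ker, MonoidHom.comp_apply]
    change e _ = 1 ↔ _
    rw [map_eq_one_iff _ e.injective]
    exact QuotientGroup.eq_one_iff g

end PGroups

end Beauville

namespace Beauville

/-! ### Orders of the derived subgroup and the Frattini quotient in maximal class. -/

section MaximalClass

variable {p n : ℕ} {G : Type*} [Group G]

theorem lowerCentralSeries_eq_bot_of_succ_eq [Group.IsNilpotent G] {k : ℕ}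
    (h : (⊤ : Subgroup G).lowerCentralSeries (k + 1) = (⊤ : Subgroup G).lowerCentralSeries k) :
    (⊤ : Subgroup G).lowerCentralSeries k = ⊥ := by
  have hconst : ∀ j, (⊤ : Subgroup G).lowerCentralSeries (k + j) =
      (⊤ : Subgroup G).lowerCentralSeries k := by
    intro j
    induction j with
    | zero => rfl
    | succ j ih =>
      rw [← add_assoc, Subgroup.lowerCentralSeries_succ, ih, ← Subgroup.lowerCentralSeries_succ, h]
  rw [← hconst (Group.nilpotencyClass G), eq_bot_iff, ← Subgroup.lowerCentralSeries_nilpotencyClass]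
  exact Subgroup.lowerCentralSeries_antitone _ (Nat.le_add_left _ _)

theorem IsMaximalClass.isPGroup (hG : IsMaximalClass p n G) : IsPGroup p G :=
  IsPGroup.of_card hG.card_eq

theorem IsMaximalClass.finite (hp : p.Prime) (hG : IsMaximalClass p n G) : Finite G :=
  Nat.finite_of_card_ne_zero (hG.card_eq ▸ pow_ne_zero n hp.ne_zero)

theorem IsMaximalClass.lowerCentralSeries_ne_bot (hG : IsMaximalClass p n G) {k : ℕ}
    (hk : k + 1 < n) : (⊤ : Subgroup G).lowerCentralSeries k ≠ ⊥ := by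
  have := hG.nilpotent
  intro h
  have := Subgroup.lowerCentralSeries_eq_bot_iff_nilpotencyClass_le.mp h
  have := hG.class_eq
  omega

theorem mul_card_le_of_lt [Fact p.Prime] [Finite G] (hG : IsPGroup p G)
    {H K : Subgroup G} (h : H < K) : p * Nat.card H ≤ Nat.card K := by
  have hp : p.Prime := Fact.out
  obtain ⟨a, ha⟩ := IsPGroup.iff_card.mp (hG.to_subgroup H)
  obtain ⟨b, hb⟩ := IsPGroup.iff_card.mp (hG.to_subgroup K)
  have hlt : Nat.card H < Nat.card K := by
    refine lt_of_le_of_ne (Subgroup.card_le_of_le h.le) fun heq => h.ne ?_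
    exact Subgroup.eq_of_le_of_card_ge h.le heq.ge
  rw [ha, hb] at hlt ⊢
  rw [← pow_succ']
  exact Nat.pow_le_pow_right hp.pos ((Nat.pow_lt_pow_iff_right hp.one_lt).mp hlt)

/-- The series is strictly decreasing until it reaches 1, and each strict step costs a factor of at
least p. -/
theorem IsMaximalClass.pow_le_card_lowerCentralSeries (hp : p.Prime) (hG : IsMaximalClass p n G)
    (j k : ℕ) (hjk : k + j + 1 = n) :
    p ^ j ≤ Nat.card ((⊤ : Subgroup G).lowerCentralSeries k) := by
  have := Fact.mk hp
  have := hG.finite hp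
  have := hG.nilpotent
  induction j generalizing k with
  | zero => exact Nat.card_pos
  | succ j ih =>
    rw [pow_succ']
    refine (Nat.mul_le_mul_left p (ih (k + 1) (by omega))).trans ?_
    refine mul_card_le_of_lt hG.isPGroup
      (lt_of_le_of_ne (Subgroup.lowerCentralSeries_antitone _ (Nat.le_succ k)) fun h => ?_)
    exact hG.lowerCentralSeries_ne_bot (by omega) (lowerCentralSeries_eq_bot_of_succ_eq h)

theorem IsMaximalClass.not_isCyclic (hG : IsMaximalClass p n G) (hn : 3 ≤ n) :
    ¬ IsCyclic G := by
  intro h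
  refine hG.lowerCentralSeries_ne_bot (k := 1) (by omega) ?_
  rw [Subgroup.top_lowerCentralSeries_one, commutator_eq_bot_iff]
  exact IsCyclic.isMulCommutative

theorem not_isCyclic_quotient_frattini [Finite G] (h : ¬ IsCyclic G) :
    ¬ IsCyclic (G ⧸ frattini G) := by
  rintro ⟨x, hx⟩
  obtain ⟨g, rfl⟩ := QuotientGroup.mk'_surjective (frattini G) x
  refine h ⟨g, fun y => ?_⟩
  have : Subgroup.zpowers g = ⊤ := by
    refine eq_top_of_map_frattini_eq_top ?_
    rw [MonoidHom.map_zpowers, eq_top_iff]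
    exact fun y _ => hx y
  exact Subgroup.mem_zpowers_iff.mp (this ▸ Subgroup.mem_top y)

/-- The bound |G'| ≥ p^(n-2) and G' ≤ Φ(G) give at most p^2; a smaller quotient would be cyclic, and
then so would G. -/
theorem IsMaximalClass.card_quotient_frattini (hp : p.Prime) (hG : IsMaximalClass p n G)
    (hn : 3 ≤ n) : Nat.card (G ⧸ frattini G) = p ^ 2 := by
  have := Fact.mk hp
  have := hG.finite hp
  have hle : Nat.card (G ⧸ frattini G) * p ^ (n - 2) ≤ p ^ 2 * p ^ (n - 2) := by
    have h1 := hG.pow_le_card_lowerCentralSeries hp (n - 2) 1 (by omega)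
    rw [Subgroup.top_lowerCentralSeries_one] at h1
    have h2 := Subgroup.card_le_of_le (commutator_le_frattini hG.isPGroup)
    have h3 := Subgroup.card_eq_card_quotient_mul_card_subgroup (frattini G)
    rw [← pow_add, show 2 + (n - 2) = n by omega, ← hG.card_eq, h3]
    exact Nat.mul_le_mul_left _ (h1.trans h2)
  have hle' := Nat.le_of_mul_le_mul_right hle (pow_pos hp.pos _)
  obtain ⟨k, hk⟩ := IsPGroup.iff_card.mp (hG.isPGroup.to_quotient (frattini G))
  have hnc := not_isCyclic_quotient_frattini (hG.not_isCyclic hn)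
  rw [hk] at hle' ⊢
  have hk2 : k ≤ 2 := (Nat.pow_le_pow_iff_right hp.one_lt).mp hle'
  interval_cases k
  · refine absurd ?_ hnc
    have := (Nat.card_eq_one_iff_unique.mp hk).1
    infer_instance
  · exact absurd (isCyclic_of_prime_card (by simpa using hk)) hnc
  · rfl

theorem IsMaximalClass.card_commutator (hp : p.Prime) (hG : IsMaximalClass p n G)
    (hn : 3 ≤ n) : commutator G = frattini G ∧ Nat.card (commutator G) = p ^ (n - 2) := by
  have := Fact.mk hp
  have := hG.finite hp
  have h1 := hG.pow_le_card_lowerCentralSeries hp (n - 2) 1 (by omega)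
  rw [Subgroup.top_lowerCentralSeries_one] at h1
  have h3 := Subgroup.card_eq_card_quotient_mul_card_subgroup (frattini G)
  rw [hG.card_quotient_frattini hp hn, hG.card_eq,
    ← Nat.add_sub_of_le (show 2 ≤ n by omega), pow_add] at h3
  have h4 := Nat.eq_of_mul_eq_mul_left (pow_pos hp.pos _) h3
  have h5 : commutator G = frattini G :=
    Subgroup.eq_of_le_of_card_ge (commutator_le_frattini hG.isPGroup) (h4 ▸ h1)
  exact ⟨h5, h5 ▸ h4.symm⟩

end MaximalClass

end Beauville

namespace Beauville

/-! ### Commutators and p-th powers outside an abelian maximal subgroup. -/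

section AbelianMaximal

variable {p n : ℕ} {G : Type*} [Group G] {M : Subgroup G}

theorem eq_top_of_isCoatom_le_of_mem (hM : IsCoatom M) {K : Subgroup G} (hMK : M ≤ K) {t : G}
    (ht : t ∉ M) (htK : t ∈ K) : K = ⊤ :=
  hM.2 K (lt_of_le_of_ne hMK fun h => ht (h ▸ htK))

theorem mem_center_of_commute (hM : IsCoatom M) (hA : IsMulCommutative M) {t z : G} (ht : t ∉ M)
    (hz : z ∈ M) (hzt : Commute z t) : z ∈ Subgroup.center G := by
  have htop : Subgroup.centralizer {z} = ⊤ := by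
    refine eq_top_of_isCoatom_le_of_mem hM (fun a ha => ?_) ht ?_
    · exact Subgroup.mem_centralizer_singleton_iff.mpr (setLike_mul_comm ha hz)
    · exact Subgroup.mem_centralizer_singleton_iff.mpr hzt.eq.symm
  rw [Subgroup.mem_center_iff]
  intro g
  exact Subgroup.mem_centralizer_singleton_iff.mp (htop ▸ Subgroup.mem_top g)

theorem inv_mul_mul_mem (hN : M.Normal) {a : G} (t : G) (ha : a ∈ M) : t⁻¹ * a * t ∈ M := by
  simpa using hN.conj_mem a ha t⁻¹

theorem mul_mul_inv_mem (hN : M.Normal) {a : G} (t : G) (ha : a ∈ M) : t * a * t⁻¹ ∈ M :=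
  hN.conj_mem a ha t

/-- The homomorphism `m ↦ [t, m]` on an abelian normal subgroup. -/
def commutatorHom (hN : M.Normal) (hA : IsMulCommutative M) (t : G) : M →* G where
  toFun m := t⁻¹ * (m : G)⁻¹ * t * m
  map_one' := by simp
  map_mul' a b := by
    have h1 : (t⁻¹ * (b : G)⁻¹ * t) * (t⁻¹ * (a : G)⁻¹ * t * a) =
        (t⁻¹ * (a : G)⁻¹ * t * a) * (t⁻¹ * (b : G)⁻¹ * t) :=
      setLike_mul_comm (inv_mul_mul_mem hN t (inv_mem b.2))
        (mul_mem (inv_mul_mul_mem hN t (inv_mem a.2)) a.2)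
    calc t⁻¹ * ((a * b : M) : G)⁻¹ * t * ((a * b : M) : G)
        = (t⁻¹ * (b : G)⁻¹ * t) * (t⁻¹ * (a : G)⁻¹ * t * a) * b := by
          simp only [Subgroup.coe_mul]
          group
      _ = _ := by
          rw [h1]
          group

theorem commutatorHom_apply (hN : M.Normal) (hA : IsMulCommutative M) (t : G) (m : M) :
    commutatorHom hN hA t m = t⁻¹ * (m : G)⁻¹ * t * m := rfl

theorem commutatorHom_mem (hN : M.Normal) (hA : IsMulCommutative M) (t : G) (m : M) :
    commutatorHom hN hA t m ∈ M :=
  mul_mem (inv_mul_mul_mem hN t (inv_mem m.2)) m.2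

/-- The normalizer contains M, which centralizes the range, and t, which sends [t, m] to [t, tmt⁻¹];
maximality of M does the rest. -/
theorem range_commutatorHom_normal (hM : IsCoatom M) (hN : M.Normal) (hA : IsMulCommutative M)
    {t : G} (ht : t ∉ M) : (commutatorHom hN hA t).range.Normal := by
  rw [← Subgroup.normalizer_eq_top_iff]
  refine eq_top_of_isCoatom_le_of_mem hM (fun a ha => ?_) ht ?_
  · rw [Subgroup.mem_normalizer_iff]
    intro h
    constructor
    · intro hh
      have hhM : h ∈ M := by
        obtain ⟨m, rfl⟩ := hh
        exact commutatorHom_mem hN hA t m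
      rw [setLike_mul_comm ha hhM, mul_inv_cancel_right]
      exact hh
    · intro hh
      have hhM : a * h * a⁻¹ ∈ M := by
        obtain ⟨m, hm⟩ := hh
        rw [← hm]
        exact commutatorHom_mem hN hA t m
      have hhM' : h ∈ M := by
        have := inv_mul_mul_mem hN a hhM
        simpa [mul_assoc] using this
      rwa [setLike_mul_comm ha hhM', mul_inv_cancel_right] at hh
  · rw [Subgroup.mem_normalizer_iff]
    intro h
    constructor
    · rintro ⟨m, rfl⟩
      refine ⟨⟨t * m * t⁻¹, mul_mul_inv_mem hN t m.2⟩, ?_⟩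
      simp only [commutatorHom_apply]
      group
    · rintro ⟨m, hm⟩
      refine ⟨⟨t⁻¹ * m * t, inv_mul_mul_mem hN t m.2⟩, ?_⟩
      have : h = t⁻¹ * (t * h * t⁻¹) * t := by group
      rw [this, ← hm]
      simp only [commutatorHom_apply]
      group

/-- Modulo the range D, t commutes with the abelian M. As M and t generate G, both become central,
so G/D is abelian. -/
theorem commutator_le_range_commutatorHom (hM : IsCoatom M) (hN : M.Normal)
    (hA : IsMulCommutative M) {t : G} (ht : t ∉ M) :
    commutator G ≤ (commutatorHom hN hA t).range := by
  have hD := range_commutatorHom_normal hM hN hA ht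
  set D := (commutatorHom hN hA t).range with hDdef
  have hcomm : ∀ a ∈ M, (a : G ⧸ D) * t = t * a := by
    intro a ha
    rw [← QuotientGroup.mk_mul, ← QuotientGroup.mk_mul]
    refine QuotientGroup.eq.mpr ⟨⟨a, ha⟩, ?_⟩
    rw [commutatorHom_apply]
    group
  have hcen : ∀ x : G, (∀ a ∈ M, (a : G ⧸ D) * x = x * a) → (t : G ⧸ D) * x = x * t →
      (x : G ⧸ D) ∈ Subgroup.center (G ⧸ D) := by
    intro x h1 h2
    have htop : (Subgroup.centralizer {(x : G ⧸ D)}).comap (QuotientGroup.mk' D) = ⊤ := by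
      refine eq_top_of_isCoatom_le_of_mem hM (fun a ha => ?_) ht ?_
      · exact Subgroup.mem_centralizer_singleton_iff.mpr (h1 a ha)
      · exact Subgroup.mem_centralizer_singleton_iff.mpr h2
    rw [Subgroup.mem_center_iff]
    intro g
    obtain ⟨g, rfl⟩ := QuotientGroup.mk'_surjective D g
    exact Subgroup.mem_centralizer_singleton_iff.mp
      (Subgroup.mem_comap.mp (htop ▸ Subgroup.mem_top g))
  have htop : (Subgroup.center (G ⧸ D)).comap (QuotientGroup.mk' D) = ⊤ := by
    refine eq_top_of_isCoatom_le_of_mem hM (fun a ha => ?_) ht ?_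
    · refine hcen a (fun b hb => ?_) (hcomm a ha).symm
      rw [← QuotientGroup.mk_mul, ← QuotientGroup.mk_mul, setLike_mul_comm ha hb]
    · exact hcen t hcomm rfl
  refine (Subgroup.Normal.quotient_commutative_iff_commutator_le).mp ?_
  refine isMulCommutative_iff.mpr fun a b => ?_
  obtain ⟨b, rfl⟩ := QuotientGroup.mk'_surjective D b
  exact Subgroup.mem_center_iff.mp (Subgroup.mem_comap.mp (htop ▸ Subgroup.mem_top b)) a

theorem range_commutatorHom (hM : IsCoatom M) (hN : M.Normal) (hA : IsMulCommutative M) {t : G}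
    (ht : t ∉ M) : (commutatorHom hN hA t).range = commutator G := by
  refine le_antisymm ?_ (commutator_le_range_commutatorHom hM hN hA ht)
  rintro _ ⟨m, rfl⟩
  have h := Subgroup.commutator_mem_commutator (Subgroup.mem_top t⁻¹) (Subgroup.mem_top (m : G)⁻¹)
  rw [commutatorElement_def, inv_inv, inv_inv] at h
  exact h

/-- Outside an abelian maximal normal subgroup, conjugacy classes are unions of cosets of the
derived subgroup. -/
theorem exists_conj_eq_mul (hM : IsCoatom M) (hN : M.Normal) (hA : IsMulCommutative M) {t c : G}
    (ht : t ∉ M) (hc : c ∈ commutator G) : ∃ m : G, t * c = m⁻¹ * t * m := by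
  rw [← range_commutatorHom hM hN hA ht] at hc
  obtain ⟨m, rfl⟩ := hc
  refine ⟨m, ?_⟩
  rw [commutatorHom_apply]
  group

theorem exists_pow_mul_eq [Finite G] (hM : IsCoatom M) (hN : M.Normal) {t : G} (ht : t ∉ M)
    (v : G) : ∃ k : ℕ, ∃ m ∈ M, v = t ^ k * m := by
  have htop : Subgroup.zpowers t ⊔ M = ⊤ :=
    eq_top_of_isCoatom_le_of_mem hM le_sup_right ht
      ((le_sup_left : Subgroup.zpowers t ≤ _) (Subgroup.mem_zpowers t))
  have hv : v ∈ Subgroup.zpowers t ⊔ M := htop ▸ Subgroup.mem_top v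
  obtain ⟨y, hy, m, hm, h⟩ := Subgroup.mem_sup_of_normal_right.mp hv
  rw [← mem_powers_iff_mem_zpowers] at hy
  obtain ⟨k, rfl⟩ := hy
  exact ⟨k, m, hm, h.symm⟩

theorem pow_mem_center (hM : IsCoatom M) (hA : IsMulCommutative M) {t : G} (ht : t ∉ M) {k : ℕ}
    (hk : t ^ k ∈ M) : t ^ k ∈ Subgroup.center G :=
  mem_center_of_commute hM hA ht hk ((Commute.refl t).pow_left k)

/-- Since (rm)^k is r^k times a product of conjugates of m by powers of r, all in the abelian M, the
map m ↦ r^{-k}(rm)^k is multiplicative on M. -/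
theorem mul_pow_eq (hN : M.Normal) (hA : IsMulCommutative M) (r : G) {a b : G} (ha : a ∈ M)
    (hb : b ∈ M) (k : ℕ) :
    (r ^ k)⁻¹ * (r * a) ^ k ∈ M ∧
      (r ^ k)⁻¹ * (r * (a * b)) ^ k = (r ^ k)⁻¹ * (r * a) ^ k * ((r ^ k)⁻¹ * (r * b) ^ k) := by
  have hstep : ∀ (c : G) (k : ℕ), (r ^ (k + 1))⁻¹ * (r * c) ^ (k + 1) =
      r⁻¹ * ((r ^ k)⁻¹ * (r * c) ^ k) * r * c := by
    intro c k
    rw [pow_succ, pow_succ]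
    group
  have hmem : ∀ c ∈ M, ∀ k : ℕ, (r ^ k)⁻¹ * (r * c) ^ k ∈ M := by
    intro c hc k
    induction k with
    | zero => simp
    | succ k ih =>
      rw [hstep]
      exact mul_mem (inv_mul_mul_mem hN r ih) hc
  refine ⟨hmem a ha k, ?_⟩
  induction k with
  | zero => simp
  | succ k ih =>
    rw [hstep, hstep, hstep, ih]
    have h1 : r⁻¹ * ((r ^ k)⁻¹ * (r * b) ^ k) * r * a = a * (r⁻¹ * ((r ^ k)⁻¹ * (r * b) ^ k) * r) :=
      setLike_mul_comm (inv_mul_mul_mem hN r (hmem b hb k)) ha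
    generalize (r ^ k)⁻¹ * (r * b) ^ k = y at h1 ⊢
    generalize (r ^ k)⁻¹ * (r * a) ^ k = x
    calc r⁻¹ * (x * y) * r * (a * b) = r⁻¹ * x * r * (r⁻¹ * y * r * a) * b := by group
      _ = r⁻¹ * x * r * a * (r⁻¹ * y * r * b) := by
        rw [h1]
        group

/-- The elements `m` of an abelian normal subgroup with `(rm)^k = 1`, where `r^k = 1`. -/
def mulPowKer (hN : M.Normal) (hA : IsMulCommutative M) {r : G} {k : ℕ} (hr : r ^ k = 1) :
    Subgroup G where
  carrier := {m | m ∈ M ∧ (r * m) ^ k = 1}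
  one_mem' := ⟨one_mem M, by simpa using hr⟩
  mul_mem' := by
    rintro a b ⟨ha, ha'⟩ ⟨hb, hb'⟩
    refine ⟨mul_mem ha hb, ?_⟩
    have := (mul_pow_eq hN hA r ha hb k).2
    simpa [hr, ha', hb'] using this
  inv_mem' := by
    rintro a ⟨ha, ha'⟩
    refine ⟨inv_mem ha, ?_⟩
    have := (mul_pow_eq hN hA r ha (inv_mem ha) k).2
    simpa [hr, ha'] using this.symm

theorem mem_mulPowKer (hN : M.Normal) (hA : IsMulCommutative M) {r : G} {k : ℕ} (hr : r ^ k = 1)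
    {m : G} : m ∈ mulPowKer hN hA hr ↔ m ∈ M ∧ (r * m) ^ k = 1 := Iff.rfl

theorem commutator_le_mulPowKer (hM : IsCoatom M) (hN : M.Normal) (hA : IsMulCommutative M)
    (hcM : commutator G ≤ M) {r : G} (hrM : r ∉ M) {k : ℕ} (hr : r ^ k = 1) :
    commutator G ≤ mulPowKer hN hA hr := by
  intro c hc
  refine ⟨hcM hc, ?_⟩
  obtain ⟨m, hm⟩ := exists_conj_eq_mul hM hN hA hrM hc
  have h := conj_pow (i := k) (a := m⁻¹) (b := r)
  rw [inv_inv] at h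
  rw [hm, h, hr]
  group

/-- This is the kernel of m ↦ [t, m] on M, where |M| = p^(n-1) and the image G' has order p^(n-2).
-/
theorem IsMaximalClass.card_center_inf (hp : p.Prime) (hG : IsMaximalClass p n G) (hn : 3 ≤ n)
    (hM : IsCoatom M) (hA : IsMulCommutative M) :
    Nat.card (Subgroup.center G ⊓ M : Subgroup G) = p := by
  have := Fact.mk hp
  have := hG.finite hp
  have hN := normal_of_isCoatom hG.isPGroup hM
  obtain ⟨t, ht⟩ : ∃ t, t ∉ M := by
    by_contra! h
    exact hM.1 (eq_top_iff.mpr fun x _ => h x)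
  have hker : Subgroup.center G ⊓ M = (commutatorHom hN hA t).ker.map M.subtype := by
    ext z
    rw [Subgroup.mem_inf, Subgroup.mem_map]
    constructor
    · rintro ⟨hz, hzM⟩
      refine ⟨⟨z, hzM⟩, ?_, rfl⟩
      rw [MonoidHom.mem_ker, commutatorHom_apply]
      have := Subgroup.mem_center_iff.mp (inv_mem hz) t⁻¹
      rw [this]
      simp
    · rintro ⟨m, hm, rfl⟩
      refine ⟨mem_center_of_commute hM hA ht m.2 ?_, m.2⟩
      rw [MonoidHom.mem_ker, commutatorHom_apply] at hm
      have h2 : t * (m : G) = m * t := by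
        have : (m : G) * t * (t⁻¹ * (m : G)⁻¹ * t * m) = m * t := by rw [hm, mul_one]
        rw [← this]
        group
      exact h2.symm
  have h1 : Nat.card M * p = p ^ n := by
    rw [← hG.card_eq, ← Subgroup.card_mul_index M, index_of_isCoatom hG.isPGroup hM]
  have h2 := Subgroup.card_mul_index (commutatorHom hN hA t).ker
  rw [Subgroup.index_ker, range_commutatorHom hM hN hA ht, (hG.card_commutator hp hn).2] at h2
  rw [hker, Subgroup.card_map_of_injective M.subtype_injective]
  rw [← h2, ← Nat.add_sub_of_le (show 2 ≤ n by omega), pow_add, Nat.add_sub_cancel_left] at h1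
  have hpos : 0 < p ^ (n - 2) * p := mul_pos (pow_pos hp.pos _) hp.pos
  refine Nat.eq_of_mul_eq_mul_right hpos ?_
  rw [← mul_assoc, h1]
  ring

theorem IsMaximalClass.mem_zpowers_of_pow_ne_one (hp : p.Prime) (hG : IsMaximalClass p n G)
    (hn : 3 ≤ n) (hM : IsCoatom M) (hA : IsMulCommutative M) {t z : G} (ht : t ∉ M)
    (htp : t ^ p ≠ 1) (hz : z ∈ Subgroup.center G ⊓ M) : z ∈ Subgroup.zpowers t := by
  have := Fact.mk hp
  have := hG.finite hp
  have htM := pow_mem_of_isCoatom hG.isPGroup hM t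
  have htZ : t ^ p ∈ Subgroup.center G ⊓ M := ⟨pow_mem_center hM hA ht htM, htM⟩
  have h := mem_zpowers_of_prime_card (hG.card_center_inf hp hn hM hA)
    (g := ⟨t ^ p, htZ⟩) (g' := ⟨z, hz⟩) (by simpa [Subtype.ext_iff] using htp)
  obtain ⟨k, hk⟩ := h
  have hk' : (t ^ p) ^ k = z := by simpa using congrArg Subtype.val hk
  rw [← hk']
  exact zpow_mem (pow_mem (Subgroup.mem_zpowers t) p) k

/-- Some power v^k with k prime to p lies in rM, so v^(pk) = 1; also v^(p^2) = 1, because v^p lies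
in the group Z(G) ∩ M of order p. -/
theorem IsMaximalClass.pow_eq_one_of_forall_mul_pow_eq_one (hp : p.Prime)
    (hG : IsMaximalClass p n G) (hn : 3 ≤ n) (hM : IsCoatom M) (hA : IsMulCommutative M) {r : G}
    (hr : ∀ m ∈ M, (r * m) ^ p = 1) (hrM : r ∉ M) {v : G} (hv : v ∉ M) : v ^ p = 1 := by
  have := Fact.mk hp
  have := hG.finite hp
  have hN := normal_of_isCoatom hG.isPGroup hM
  have hvM := pow_mem_of_isCoatom hG.isPGroup hM v
  obtain ⟨k, m, hm, hk⟩ := exists_pow_mul_eq hM hN hv r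
  have hvk : (v ^ p) ^ k = 1 := by
    rw [← pow_mul, mul_comm, pow_mul, ← hr m⁻¹ (inv_mem hm), hk, mul_inv_cancel_right]
  have hvp : (v ^ p) ^ p = 1 := by
    have hvZ : v ^ p ∈ Subgroup.center G ⊓ M := ⟨pow_mem_center hM hA hv hvM, hvM⟩
    have := pow_card_eq_one' (x := (⟨v ^ p, hvZ⟩ : (Subgroup.center G ⊓ M : Subgroup G)))
    rw [hG.card_center_inf hp hn hM hA] at this
    simpa using congrArg Subtype.val this
  have hcop : Nat.Coprime k p := by
    rw [Nat.coprime_comm, hp.coprime_iff_not_dvd]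
    rintro ⟨j, rfl⟩
    refine hrM ?_
    rw [hk, pow_mul]
    exact mul_mem (pow_mem hvM j) hm
  have := pow_gcd_eq_one.mpr ⟨hvk, hvp⟩
  rwa [hcop, pow_one] at this

/-- The subgroup `mulPowKer` contains G', which has index p in M, and also m outside G'; hence it is
all of M. -/
theorem IsMaximalClass.pow_eq_one_of_two_cosets (hp : p.Prime)
    (hG : IsMaximalClass p n G) (hn : 3 ≤ n) (hM : IsCoatom M) (hA : IsMulCommutative M) {r m : G}
    (hrM : r ∉ M) (hr : r ^ p = 1) (hm : m ∈ M) (hmc : m ∉ commutator G) (hrm : (r * m) ^ p = 1)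
    {v : G} (hv : v ∉ M) : v ^ p = 1 := by
  have := Fact.mk hp
  have := hG.finite hp
  have hN := normal_of_isCoatom hG.isPGroup hM
  have hlt : commutator G < mulPowKer hN hA hr :=
    lt_of_le_of_ne (commutator_le_mulPowKer hM hN hA
      (commutator_le_of_isCoatom hG.isPGroup hM) hrM hr)
      fun h => hmc (h ▸ (mem_mulPowKer hN hA hr).mpr ⟨hm, hrm⟩)
  have h1 := mul_card_le_of_lt hG.isPGroup hlt
  have h2 : Nat.card M * p = p ^ n := by
    rw [← hG.card_eq, ← Subgroup.card_mul_index M, index_of_isCoatom hG.isPGroup hM]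
  have hle : mulPowKer hN hA hr ≤ M := fun x hx => hx.1
  have heq : mulPowKer hN hA hr = M := by
    refine Subgroup.eq_of_le_of_card_ge hle (le_trans ?_ h1)
    rw [(hG.card_commutator hp hn).2]
    refine Nat.le_of_mul_le_mul_right (c := p) ?_ hp.pos
    rw [h2, ← Nat.add_sub_of_le (show 2 ≤ n by omega), pow_add, Nat.add_sub_cancel_left]
    exact le_of_eq (by ring)
  refine hG.pow_eq_one_of_forall_mul_pow_eq_one hp hn hM hA (fun m' hm' => ?_) hrM hv
  rw [← heq] at hm'
  exact hm'.2

end AbelianMaximal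

end Beauville

namespace Beauville

/-! ### Determinants on the Frattini quotient. -/

section Coordinates

variable {p n : ℕ} {G : Type*} [Group G] {M : Subgroup G}

/-- The determinant of two elements of `G` with respect to coordinates in `ZMod p × ZMod p`. -/
def coordDet (π : G →* Multiplicative (ZMod p × ZMod p)) (g h : G) : ZMod p :=
  (π g).toAdd.1 * (π h).toAdd.2 - (π g).toAdd.2 * (π h).toAdd.1

variable (π : G →* Multiplicative (ZMod p × ZMod p))

theorem coordDet_mul_left (a b c : G) :
    coordDet π (a * b) c = coordDet π a c + coordDet π b c := by
  simp only [coordDet, map_mul, toAdd_mul, Prod.fst_add, Prod.snd_add]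
  ring

theorem coordDet_mul_right (a b c : G) :
    coordDet π a (b * c) = coordDet π a b + coordDet π a c := by
  simp only [coordDet, map_mul, toAdd_mul, Prod.fst_add, Prod.snd_add]
  ring

theorem coordDet_self (a : G) : coordDet π a a = 0 := by
  simp only [coordDet]
  ring

theorem coordDet_swap (a b : G) : coordDet π a b = -coordDet π b a := by
  simp only [coordDet]
  ring

theorem coordDet_zpow_left (a b : G) (k : ℤ) :
    coordDet π (a ^ k) b = k * coordDet π a b := by
  simp only [coordDet, map_zpow, toAdd_zpow, Prod.smul_fst, Prod.smul_snd]
  simp only [zsmul_eq_mul]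
  ring

theorem coordDet_pow_left (a b : G) (k : ℕ) :
    coordDet π (a ^ k) b = k * coordDet π a b := by
  rw [← zpow_natCast, coordDet_zpow_left, Int.cast_natCast]

theorem coordDet_conj_left (g a b : G) : coordDet π (g⁻¹ * a * g) b = coordDet π a b := by
  have : π (g⁻¹ * a * g) = π a := by
    rw [map_mul, map_mul, mul_comm (π g⁻¹), mul_assoc, ← map_mul, inv_mul_cancel, map_one, mul_one]
  simp only [coordDet, this]

theorem coordDet_of_map_eq_one_left {a : G} (ha : π a = 1) (b : G) : coordDet π a b = 0 := by
  simp [coordDet, ha]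

/-- The elements whose determinant against a fixed element vanishes. -/
def coordDetKer (a : G) : Subgroup G where
  carrier := {g | coordDet π a g = 0}
  one_mem' := by simp [coordDet]
  mul_mem' := by
    intro b c hb hc
    rw [Set.mem_ofPred_eq] at hb hc ⊢
    rw [coordDet_mul_right, hb, hc, add_zero]
  inv_mem' := by
    intro b hb
    rw [Set.mem_ofPred_eq] at hb ⊢
    have h := coordDet_mul_right π a b b⁻¹
    rw [mul_inv_cancel, hb, zero_add] at h
    rw [← h]
    simp [coordDet]

variable {π}

theorem map_eq_one_of_forall_coordDet_eq_zero (hπ : Function.Surjective π) {a : G}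
    (h : ∀ g, coordDet π a g = 0) : π a = 1 := by
  obtain ⟨g₁, hg₁⟩ := hπ (Multiplicative.ofAdd (0, 1))
  obtain ⟨g₂, hg₂⟩ := hπ (Multiplicative.ofAdd (1, 0))
  have h1 := h g₁
  have h2 := h g₂
  simp only [coordDet, hg₁, hg₂, toAdd_ofAdd, mul_one, mul_zero, sub_zero, zero_sub,
    neg_eq_zero] at h1 h2
  exact Multiplicative.toAdd.injective (Prod.ext h1 h2)

/-- If the determinant vanished, x and y would pair to zero with both generators, hence with all of
G; nondegeneracy would make π trivial. -/
theorem coordDet_ne_zero_of_closure_eq_top [Fact p.Prime] (hπ : Function.Surjective π) {x y : G}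
    (h : Subgroup.closure {x, y} = ⊤) : coordDet π x y ≠ 0 := by
  intro hxy
  have hyx : coordDet π y x = 0 := by rw [coordDet_swap, hxy, neg_zero]
  have key : ∀ a : G, coordDet π a x = 0 → coordDet π a y = 0 → π a = 1 := by
    intro a hx hy
    refine map_eq_one_of_forall_coordDet_eq_zero hπ fun g => ?_
    have hle : Subgroup.closure {x, y} ≤ coordDetKer π a := by
      rw [Subgroup.closure_le]
      rintro g (rfl | rfl)
      · exact hx
      · exact hy
    exact hle (h ▸ Subgroup.mem_top g)
  have hker : Subgroup.closure {x, y} ≤ π.ker := by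
    rw [Subgroup.closure_le]
    rintro g (rfl | rfl)
    · exact key _ (coordDet_self π _) hxy
    · exact key _ hyx (coordDet_self π _)
  obtain ⟨g, hg⟩ := hπ (Multiplicative.ofAdd (1, 0))
  have h1 : π g = 1 := hker (h ▸ Subgroup.mem_top g)
  rw [h1] at hg
  exact zero_ne_one (congrArg (fun v => (Multiplicative.toAdd v).1) hg)

theorem exists_map_eq_pow_of_coordDet_eq_zero [Fact p.Prime] {t u : G} (ht : π t ≠ 1)
    (h : coordDet π t u = 0) : ∃ k : ℕ, π u = π (t ^ k) := by
  rw [coordDet] at h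
  have hne : (π t).toAdd.1 ≠ 0 ∨ (π t).toAdd.2 ≠ 0 := by
    by_contra! hc
    exact ht (Multiplicative.toAdd.injective (Prod.ext hc.1 hc.2))
  have key : ∀ c : ZMod p, (π u).toAdd.1 = c * (π t).toAdd.1 →
      (π u).toAdd.2 = c * (π t).toAdd.2 → ∃ k : ℕ, π u = π (t ^ k) := by
    intro c h1 h2
    refine ⟨c.val, Multiplicative.toAdd.injective (Prod.ext ?_ ?_)⟩
    · rw [map_pow, toAdd_pow, Prod.smul_fst, nsmul_eq_mul, ZMod.natCast_zmod_val, h1]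
    · rw [map_pow, toAdd_pow, Prod.smul_snd, nsmul_eq_mul, ZMod.natCast_zmod_val, h2]
  rcases hne with h1 | h1
  · refine key ((π u).toAdd.1 / (π t).toAdd.1) (by field_simp) ?_
    field_simp
    linear_combination h
  · refine key ((π u).toAdd.2 / (π t).toAdd.2) ?_ (by field_simp)
    field_simp
    linear_combination -h

theorem closure_eq_top_of_coordDet_ne_zero [Fact p.Prime] [Finite G]
    (hker : π.ker = frattini G) {x y : G} (h : coordDet π x y ≠ 0) :
    Subgroup.closure {x, y} = ⊤ := by
  refine frattini_nongenerating ?_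
  rw [← hker, ← Subgroup.comap_map_eq, eq_top_iff]
  intro g _
  -- Cramer's rule: the coordinates of g in the basis given by x and y.
  set a := coordDet π g y / coordDet π x y with ha
  set b := coordDet π x g / coordDet π x y with hb
  refine Subgroup.mem_comap.mpr (Subgroup.mem_map.mpr ⟨x ^ a.val * y ^ b.val, ?_, ?_⟩)
  · have hx : x ∈ Subgroup.closure {x, y} := Subgroup.subset_closure (by simp)
    have hy : y ∈ Subgroup.closure {x, y} := Subgroup.subset_closure (by simp)
    exact mul_mem (pow_mem hx _) (pow_mem hy _)
  · have h' := h
    rw [coordDet] at h'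
    apply Multiplicative.toAdd.injective
    refine Prod.ext ?_ ?_
    · rw [map_mul, map_pow, map_pow, toAdd_mul, toAdd_pow, toAdd_pow, Prod.fst_add, Prod.smul_fst,
        Prod.smul_fst, nsmul_eq_mul, nsmul_eq_mul, ZMod.natCast_zmod_val, ZMod.natCast_zmod_val,
        ha, hb, coordDet, coordDet, coordDet]
      rw [div_mul_eq_mul_div, div_mul_eq_mul_div, ← add_div, div_eq_iff h']
      ring
    · rw [map_mul, map_pow, map_pow, toAdd_mul, toAdd_pow, toAdd_pow, Prod.snd_add, Prod.smul_snd,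
        Prod.smul_snd, nsmul_eq_mul, nsmul_eq_mul, ZMod.natCast_zmod_val, ZMod.natCast_zmod_val,
        ha, hb, coordDet, coordDet, coordDet]
      rw [div_mul_eq_mul_div, div_mul_eq_mul_div, ← add_div, div_eq_iff h']
      ring

/-- Independent elements generate G, so a maximal subgroup cannot contain two of them. -/
theorem coordDet_eq_zero_of_mem [Fact p.Prime] [Finite G] (hker : π.ker = frattini G)
    (hM : IsCoatom M) {a b : G} (ha : a ∈ M) (hb : b ∈ M) : coordDet π a b = 0 := by
  by_contra h
  refine hM.1 (eq_top_iff.mpr ?_)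
  rw [← closure_eq_top_of_coordDet_ne_zero hker h, Subgroup.closure_le]
  rintro g (rfl | rfl)
  · exact ha
  · exact hb

end Coordinates

/-! ### Beauville structures expressed through determinants. -/

section Structure

variable {p n : ℕ} {G : Type*} [Group G] {M : Subgroup G}

theorem mem_sigmaSet_iff {x y z : G} :
    z ∈ sigmaSet x y ↔ ∃ t ∈ ({x, y, x * y} : Set G), ∃ g : G, ∃ k : ℤ, z = g⁻¹ * t ^ k * g := by
  simp only [sigmaSet, Set.mem_iUnion, Set.mem_ofPred_eq, exists_prop, Subgroup.mem_zpowers_iff,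
    exists_exists_eq_and]

theorem conj_mem_sigmaSet {x y t : G} (ht : t ∈ ({x, y, x * y} : Set G)) (g : G) (k : ℤ) :
    g⁻¹ * t ^ k * g ∈ sigmaSet x y :=
  mem_sigmaSet_iff.mpr ⟨t, ht, g, k, rfl⟩

theorem zpow_mem_sigmaSet {x y t : G} (ht : t ∈ ({x, y, x * y} : Set G)) (k : ℤ) :
    t ^ k ∈ sigmaSet x y := by
  simpa using conj_mem_sigmaSet ht 1 k

theorem mem_sigmaSet_of_mem {x y t : G} (ht : t ∈ ({x, y, x * y} : Set G)) :
    t ∈ sigmaSet x y := by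
  simpa using zpow_mem_sigmaSet ht 1

variable {π : G →* Multiplicative (ZMod p × ZMod p)}

theorem map_ne_one_of_mem_triple {x y t : G} (h : coordDet π x y ≠ 0)
    (ht : t ∈ ({x, y, x * y} : Set G)) : π t ≠ 1 := by
  intro h1
  have h0 := coordDet_of_map_eq_one_left π h1
  rcases ht with rfl | rfl | rfl
  · exact h (h0 y)
  · exact h (by rw [coordDet_swap, h0, neg_zero])
  · have := h0 y
    rw [coordDet_mul_left, coordDet_self, add_zero] at this
    exact h this

/-- The three members are pairwise independent, so at most one of them lies in M. -/
theorem exists_pair_not_mem [Fact p.Prime] [Finite G] (hker : π.ker = frattini G)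
    (hM : IsCoatom M) {x y : G} (h : coordDet π x y ≠ 0) :
    ∃ t ∈ ({x, y, x * y} : Set G), ∃ u ∈ ({x, y, x * y} : Set G),
      t ∉ M ∧ u ∉ M ∧ coordDet π t u ≠ 0 := by
  have hswap : coordDet π y x ≠ 0 := by rwa [coordDet_swap, neg_ne_zero]
  have hmul : coordDet π x (x * y) ≠ 0 := by
    rwa [coordDet_mul_right, coordDet_self, zero_add]
  have hmul' : coordDet π y (x * y) ≠ 0 := by
    rwa [coordDet_mul_right, coordDet_self, add_zero]
  by_cases hx : x ∈ M
  · exact ⟨y, by simp, x * y, by simp, fun hy => h (coordDet_eq_zero_of_mem hker hM hx hy),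
      fun hxy => hmul (coordDet_eq_zero_of_mem hker hM hx hxy), hmul'⟩
  · by_cases hy : y ∈ M
    · exact ⟨x, by simp, x * y, by simp, hx,
        fun hxy => hmul' (coordDet_eq_zero_of_mem hker hM hy hxy), hmul⟩
    · exact ⟨x, by simp, y, by simp, hx, hy, h⟩

/-- Taking determinants against t₂, which ignore conjugation, forces p ∣ k. -/
theorem zpow_eq_one_of_conj_eq [Fact p.Prime] {t₁ t₂ g h : G} {k l : ℤ}
    (hd : coordDet π t₁ t₂ ≠ 0) (ht : t₁ ^ p = 1) (he : g⁻¹ * t₁ ^ k * g = h⁻¹ * t₂ ^ l * h) :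
    t₁ ^ k = 1 := by
  have h1 : coordDet π (g⁻¹ * t₁ ^ k * g) t₂ = coordDet π (h⁻¹ * t₂ ^ l * h) t₂ := by rw [he]
  rw [coordDet_conj_left, coordDet_conj_left, coordDet_zpow_left, coordDet_zpow_left,
    coordDet_self, mul_zero] at h1
  obtain ⟨j, rfl⟩ := (ZMod.intCast_zmod_eq_zero_iff_dvd k p).mp ((mul_eq_zero.mp h1).resolve_right hd)
  rw [zpow_mul, zpow_natCast, ht, one_zpow]

theorem isBeauvilleStructure_of_coordDet_ne_zero [Fact p.Prime] [Finite G]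
    (hker : π.ker = frattini G) (hM : IsCoatom M) (hpow : ∀ v ∉ M, v ^ p = 1) {x₁ y₁ x₂ y₂ : G}
    (h₁ : coordDet π x₁ y₁ ≠ 0) (h₂ : coordDet π x₂ y₂ ≠ 0)
    (h : ∀ t₁ ∈ ({x₁, y₁, x₁ * y₁} : Set G), ∀ t₂ ∈ ({x₂, y₂, x₂ * y₂} : Set G),
      coordDet π t₁ t₂ ≠ 0) :
    IsBeauvilleStructure x₁ y₁ x₂ y₂ where
  ne₁ := by
    rintro rfl
    exact h₁ (coordDet_self π _)
  ne₂ := by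
    rintro rfl
    exact h₂ (coordDet_self π _)
  gen₁ := closure_eq_top_of_coordDet_ne_zero hker h₁
  gen₂ := closure_eq_top_of_coordDet_ne_zero hker h₂
  inter := by
    refine Set.Subset.antisymm ?_ ?_
    · rintro z ⟨hz₁, hz₂⟩
      obtain ⟨t₁, ht₁, g₁, k₁, rfl⟩ := mem_sigmaSet_iff.mp hz₁
      obtain ⟨t₂, ht₂, g₂, k₂, he⟩ := mem_sigmaSet_iff.mp hz₂
      have hd := h t₁ ht₁ t₂ ht₂
      rw [Set.mem_singleton_iff]
      by_cases hm : t₁ ∈ M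
      · have hm₂ : t₂ ∉ M := fun hm₂ => hd (coordDet_eq_zero_of_mem hker hM hm hm₂)
        have hd' : coordDet π t₂ t₁ ≠ 0 := by rwa [coordDet_swap, neg_ne_zero]
        rw [he, zpow_eq_one_of_conj_eq hd' (hpow _ hm₂) he.symm]
        simp
      · rw [zpow_eq_one_of_conj_eq hd (hpow _ hm) he]
        simp
    · rintro _ rfl
      exact ⟨by simpa using zpow_mem_sigmaSet (x := x₁) (y := y₁) (t := x₁) (by simp) 0,
        by simpa using zpow_mem_sigmaSet (x := x₂) (y := y₂) (t := x₂) (by simp) 0⟩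

/-- If a determinant between the triples vanished, t₂ would be a power of t₁ modulo Φ(G), and its
nontrivial image would lie in both sets Σ. -/
theorem coordDet_ne_zero_of_quotient_isBeauvilleStructure [Fact p.Prime] [Finite G]
    (hπ : Function.Surjective π) (hker : π.ker = frattini G) {x₁ y₁ x₂ y₂ : G}
    (h : IsBeauvilleStructure (x₁ : G ⧸ frattini G) (y₁ : G ⧸ frattini G)
      (x₂ : G ⧸ frattini G) (y₂ : G ⧸ frattini G)) :
    coordDet π x₁ y₁ ≠ 0 ∧ coordDet π x₂ y₂ ≠ 0 ∧
      ∀ t₁ ∈ ({x₁, y₁, x₁ * y₁} : Set G), ∀ t₂ ∈ ({x₂, y₂, x₂ * y₂} : Set G),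
        coordDet π t₁ t₂ ≠ 0 := by
  have hgen : ∀ x y : G, Subgroup.closure {(x : G ⧸ frattini G), (y : G ⧸ frattini G)} = ⊤ →
      coordDet π x y ≠ 0 := by
    intro x y hxy
    refine coordDet_ne_zero_of_closure_eq_top hπ (eq_top_of_map_frattini_eq_top ?_)
    rw [MonoidHom.map_closure, Set.image_pair]
    exact hxy
  have htriple : ∀ x y t : G, t ∈ ({x, y, x * y} : Set G) →
      (t : G ⧸ frattini G) ∈ ({(x : G ⧸ frattini G), (y : G ⧸ frattini G),
        (x : G ⧸ frattini G) * (y : G ⧸ frattini G)} : Set (G ⧸ frattini G)) := by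
    rintro x y t (rfl | rfl | rfl)
    · exact Or.inl rfl
    · exact Or.inr (Or.inl rfl)
    · exact Or.inr (Or.inr rfl)
  have hd₁ := hgen _ _ h.gen₁
  have hd₂ := hgen _ _ h.gen₂
  refine ⟨hd₁, hd₂, fun t₁ ht₁ t₂ ht₂ h0 => ?_⟩
  obtain ⟨k, hk⟩ := exists_map_eq_pow_of_coordDet_eq_zero (map_ne_one_of_mem_triple hd₁ ht₁) h0
  have heq : (t₂ : G ⧸ frattini G) = (t₁ : G ⧸ frattini G) ^ (k : ℤ) := by
    rw [zpow_natCast, ← QuotientGroup.mk_pow]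
    refine QuotientGroup.eq.mpr ?_
    rw [← hker, MonoidHom.mem_ker, map_mul, map_inv, hk, inv_mul_cancel]
  have hmem : (t₂ : G ⧸ frattini G) ∈ sigmaSet (x₁ : G ⧸ frattini G) (y₁ : G ⧸ frattini G) ∩
      sigmaSet (x₂ : G ⧸ frattini G) (y₂ : G ⧸ frattini G) :=
    ⟨heq ▸ zpow_mem_sigmaSet (htriple _ _ _ ht₁) k, mem_sigmaSet_of_mem (htriple _ _ _ ht₂)⟩
  rw [h.inter, Set.mem_singleton_iff] at hmem
  refine map_ne_one_of_mem_triple hd₂ ht₂ ?_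
  rw [← MonoidHom.mem_ker, hker]
  exact (QuotientGroup.eq_one_iff t₂).mp hmem

end Structure

end Beauville

namespace Beauville

/-! ### The two conditions, tameness, and the identification of G₁. -/

section Main

variable {p n : ℕ} {G : Type*} [Group G] {M : Subgroup G}
  {π : G →* Multiplicative (ZMod p × ZMod p)}

theorem IsMaximalClass.pow_eq_one_of_coordDet_ne_zero (hp : p.Prime) (hG : IsMaximalClass p n G)
    (hn : 3 ≤ n) (hker : π.ker = frattini G) (hM : IsCoatom M) (hA : IsMulCommutative M) {t u v : G}
    (ht : t ∉ M) (hu : u ∉ M) (hd : coordDet π t u ≠ 0) (htp : t ^ p = 1) (hup : u ^ p = 1)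
    (hv : v ∉ M) : v ^ p = 1 := by
  have := Fact.mk hp
  have := hG.finite hp
  have hN := normal_of_isCoatom hG.isPGroup hM
  obtain ⟨k, m, hm, rfl⟩ := exists_pow_mul_eq hM hN ht u
  -- If m were in G' = Φ(G), then u would be a power of t modulo Φ(G), against independence.
  refine hG.pow_eq_one_of_two_cosets hp hn hM hA (r := t ^ k) (fun h => hu (mul_mem h hm)) ?_ hm
    (fun hmc => hd ?_) hup hv
  · rw [← pow_mul, mul_comm, pow_mul, htp, one_pow]
  · rw [(hG.card_commutator hp hn).1, ← hker, MonoidHom.mem_ker] at hmc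
    rw [coordDet_swap, coordDet_mul_left, coordDet_pow_left, coordDet_self,
      coordDet_of_map_eq_one_left π hmc, mul_zero, add_zero, neg_zero]

theorem IsBeauvilleStructure.pow_eq_one (hp : p.Prime) (hG : IsMaximalClass p n G) (hn : 3 ≤ n)
    (hM : IsCoatom M) (hA : IsMulCommutative M) {x₁ y₁ x₂ y₂ : G}
    (h : IsBeauvilleStructure x₁ y₁ x₂ y₂) {v : G} (hv : v ∉ M) : v ^ p = 1 := by
  have := Fact.mk hp
  have := hG.finite hp
  obtain ⟨π, hπ, hker⟩ :=
    exists_frattini_coordinates hG.isPGroup (hG.card_quotient_frattini hp hn)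
  by_contra hvp
  have key : ∀ x y : G, Subgroup.closure {x, y} = ⊤ →
      ∃ t ∈ ({x, y, x * y} : Set G), t ∉ M ∧ t ^ p ≠ 1 := by
    intro x y hxy
    obtain ⟨t, ht, u, hu, htM, huM, hd⟩ :=
      exists_pair_not_mem hker hM (coordDet_ne_zero_of_closure_eq_top hπ hxy)
    by_cases htp : t ^ p = 1
    · exact ⟨u, hu, huM, fun hup =>
        hvp (hG.pow_eq_one_of_coordDet_ne_zero hp hn hker hM hA htM huM hd htp hup hv)⟩
    · exact ⟨t, ht, htM, htp⟩
  obtain ⟨t₁, ht₁, htM₁, htp₁⟩ := key _ _ h.gen₁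
  obtain ⟨t₂, ht₂, htM₂, htp₂⟩ := key _ _ h.gen₂
  have hnt : Nontrivial (Subgroup.center G ⊓ M : Subgroup G) :=
    Finite.one_lt_card_iff_nontrivial.mp
      (by rw [hG.card_center_inf hp hn hM hA]; exact hp.one_lt)
  obtain ⟨⟨z, hz⟩, hz1⟩ := exists_ne (1 : (Subgroup.center G ⊓ M : Subgroup G))
  obtain ⟨k, hk⟩ := hG.mem_zpowers_of_pow_ne_one hp hn hM hA htM₁ htp₁ hz
  obtain ⟨l, hl⟩ := hG.mem_zpowers_of_pow_ne_one hp hn hM hA htM₂ htp₂ hz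
  have hmem : z ∈ sigmaSet x₁ y₁ ∩ sigmaSet x₂ y₂ :=
    ⟨hk ▸ zpow_mem_sigmaSet ht₁ k, hl ▸ zpow_mem_sigmaSet ht₂ l⟩
  rw [h.inter, Set.mem_singleton_iff] at hmem
  exact hz1 (Subtype.ext hmem)

theorem eq_of_ne_zero_of_add_ne_zero (hp : p.Prime) (hp5 : p < 5) {a b : ZMod p} (ha : a ≠ 0)
    (hb : b ≠ 0) (hab : a + b ≠ 0) : a = b := by
  have h2 := hp.two_le
  interval_cases p
  · revert a b; decide
  · revert a b; decide
  · exact absurd hp (by norm_num)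

/-- The lines of x, y and xy leave at most one further line of the plane, which cannot contain both
t and u. Algebraically, a form nonzero on all three takes equal values at x and y, and the Plücker
identity then makes the product of the two determinants vanish. -/
theorem exists_coordDet_eq_zero (hp : p.Prime) (hp5 : p < 5) {x y t u : G}
    (hxy : coordDet π x y ≠ 0) (htu : coordDet π t u ≠ 0) :
    ∃ s ∈ ({x, y, x * y} : Set G), coordDet π t s = 0 ∨ coordDet π u s = 0 := by
  by_contra! h
  have := Fact.mk hp
  have key : ∀ a : G, (∀ s ∈ ({x, y, x * y} : Set G), coordDet π a s ≠ 0) →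
      coordDet π a x = coordDet π a y := by
    intro a ha
    refine eq_of_ne_zero_of_add_ne_zero hp hp5 (ha x (by simp)) (ha y (by simp)) ?_
    rw [← coordDet_mul_right]
    exact ha _ (by simp)
  have h1 := key t fun s hs => (h s hs).1
  have h2 := key u fun s hs => (h s hs).2
  refine mul_ne_zero htu hxy ?_
  have plucker : coordDet π t u * coordDet π x y =
      coordDet π t x * coordDet π u y - coordDet π t y * coordDet π u x := by
    simp only [coordDet]
    ring
  rw [plucker, h1, h2]
  ring

theorem IsBeauvilleStructure.five_le (hp : p.Prime) (hG : IsMaximalClass p n G) (hn : 3 ≤ n)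
    (hM : IsCoatom M) (hA : IsMulCommutative M) {x₁ y₁ x₂ y₂ : G}
    (h : IsBeauvilleStructure x₁ y₁ x₂ y₂) : 5 ≤ p := by
  have := Fact.mk hp
  have := hG.finite hp
  have hN := normal_of_isCoatom hG.isPGroup hM
  obtain ⟨π, hπ, hker⟩ :=
    exists_frattini_coordinates hG.isPGroup (hG.card_quotient_frattini hp hn)
  by_contra! hp5
  have hd₁ := coordDet_ne_zero_of_closure_eq_top hπ h.gen₁
  have hd₂ := coordDet_ne_zero_of_closure_eq_top hπ h.gen₂
  -- The collision is arranged outside M, where congruence modulo G' implies conjugacy.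
  obtain ⟨t, u, ht, htM, hu, hut⟩ : ∃ t s : G, t ∈ ({x₂, y₂, x₂ * y₂} : Set G) ∧ t ∉ M ∧
      s ∈ ({x₁, y₁, x₁ * y₁} : Set G) ∧ coordDet π t s = 0 := by
    obtain ⟨t, ht, u, hu, htM, huM, hd⟩ := exists_pair_not_mem hker hM hd₂
    obtain ⟨s, hs, h0 | h0⟩ := exists_coordDet_eq_zero hp hp5 hd₁ hd
    · exact ⟨t, s, ht, htM, hs, h0⟩
    · exact ⟨u, s, hu, huM, hs, h0⟩
  have hut' : coordDet π u t = 0 := by rw [coordDet_swap, hut, neg_zero]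
  obtain ⟨k, hk⟩ := exists_map_eq_pow_of_coordDet_eq_zero (map_ne_one_of_mem_triple hd₁ hu) hut'
  have hc : (u ^ k)⁻¹ * t ∈ commutator G := by
    rw [(hG.card_commutator hp hn).1, ← hker, MonoidHom.mem_ker, map_mul, map_inv, hk,
      inv_mul_cancel]
  have hkM : u ^ k ∉ M := by
    intro hm
    refine htM ?_
    have := mul_mem hm (commutator_le_of_isCoatom hG.isPGroup hM hc)
    rwa [mul_inv_cancel_left] at this
  obtain ⟨m, hm⟩ := exists_conj_eq_mul hM hN hA hkM hc
  rw [mul_inv_cancel_left, ← zpow_natCast] at hm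
  have hmem : t ∈ sigmaSet x₁ y₁ ∩ sigmaSet x₂ y₂ :=
    ⟨hm ▸ conj_mem_sigmaSet hu m k, mem_sigmaSet_of_mem ht⟩
  rw [h.inter, Set.mem_singleton_iff] at hmem
  exact htM (hmem ▸ one_mem M)

theorem two_three_ne_zero_of_five_le (hp5 : 5 ≤ p) :
    (2 : ZMod p) ≠ 0 ∧ (3 : ZMod p) ≠ 0 := by
  have key : ∀ k : ℕ, 0 < k → k < 5 → (k : ZMod p) ≠ 0 := by
    intro k hk hk5 h
    have := Nat.le_of_dvd hk ((ZMod.natCast_eq_zero_iff k p).mp h)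
    omega
  exact ⟨by exact_mod_cast key 2 (by norm_num) (by norm_num),
    by exact_mod_cast key 3 (by norm_num) (by norm_num)⟩

theorem IsMaximalClass.isBeauville (hp : p.Prime) (hG : IsMaximalClass p n G) (hn : 3 ≤ n)
    (hM : IsCoatom M) (hp5 : 5 ≤ p) (hpow : ∀ v ∉ M, v ^ p = 1) : IsBeauville G := by
  have := Fact.mk hp
  have hfin := hG.finite hp
  obtain ⟨π, hπ, hker⟩ :=
    exists_frattini_coordinates hG.isPGroup (hG.card_quotient_frattini hp hn)
  obtain ⟨x₁, hx₁⟩ := hπ (Multiplicative.ofAdd (1, 0))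
  obtain ⟨y₁, hy₁⟩ := hπ (Multiplicative.ofAdd (0, 1))
  -- The first triple has slopes 0, ∞, 1 and the second 2, 3, 4. Up to sign, all determinants that
  -- occur lie in {1, 2, 3, 4, 6}, nonzero modulo p ≥ 5.
  obtain ⟨x₂, hx₂⟩ := hπ (Multiplicative.ofAdd (1, 2))
  obtain ⟨y₂, hy₂⟩ := hπ (Multiplicative.ofAdd (-2, -6))
  obtain ⟨h2, h3⟩ := two_three_ne_zero_of_five_le hp5
  have h4 : (4 : ZMod p) ≠ 0 := by
    have := mul_ne_zero h2 h2
    norm_num at this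
    exact this
  have h6 : (6 : ZMod p) ≠ 0 := by
    have := mul_ne_zero h2 h3
    norm_num at this
    exact this
  refine ⟨hfin, x₁, y₁, x₂, y₂,
    isBeauvilleStructure_of_coordDet_ne_zero hker hM hpow ?_ ?_ ?_⟩
  · simp [coordDet, hx₁, hy₁]
  · have : coordDet π x₂ y₂ = -2 := by
      simp only [coordDet, hx₂, hy₂, toAdd_ofAdd]
      ring
    rw [this]
    exact neg_ne_zero.mpr h2
  · rintro t₁ (rfl | rfl | rfl) t₂ (rfl | rfl | rfl) <;>
      simp only [coordDet, map_mul, hx₁, hy₁, hx₂, hy₂, toAdd_mul, toAdd_ofAdd, Prod.mk_add_mk] <;>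
      ring_nf <;> simp [h2, h3, h4, h6]

theorem IsMaximalClass.isTameType (hp : p.Prime) (hG : IsMaximalClass p n G) (hn : 3 ≤ n)
    (hM : IsCoatom M) (hA : IsMulCommutative M) (hB : IsBeauville G) : IsTameType G := by
  have := Fact.mk hp
  have := hG.finite hp
  obtain ⟨π, hπ, hker⟩ :=
    exists_frattini_coordinates hG.isPGroup (hG.card_quotient_frattini hp hn)
  refine ⟨hB, fun x₁ y₁ x₂ y₂ h => ?_⟩
  obtain ⟨_, a₁, b₁, a₂, b₂, hS⟩ := hB
  obtain ⟨h₁, h₂, h₁₂⟩ := coordDet_ne_zero_of_quotient_isBeauvilleStructure hπ hker h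
  exact isBeauvilleStructure_of_coordDet_ne_zero hker hM
    (fun v hv => hS.pow_eq_one hp hG hn hM hA hv) h₁ h₂ h₁₂

theorem le_G₁ [Fact p.Prime] [Finite G] (hG : IsPGroup p G) (hM : IsCoatom M)
    (hA : IsMulCommutative M) : M ≤ G₁ G := by
  intro g hg
  rw [mem_G₁_iff]
  intro h hh
  have hhM : h ∈ M := commutator_le_of_isCoatom hG hM hh
  rw [commutatorElement_eq_one_iff_mul_comm.mpr (setLike_mul_comm hhM hg)]
  exact one_mem _

theorem IsMaximalClass.G₁_eq (hp : p.Prime) (hG : IsMaximalClass p n G) (hn : 4 ≤ n)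
    (hM : IsCoatom M) (hA : IsMulCommutative M) : G₁ G = M := by
  have := Fact.mk hp
  have := hG.finite hp
  have := hG.nilpotent
  by_contra hne
  have htop : G₁ G = ⊤ :=
    hM.2 _ (lt_of_le_of_ne (le_G₁ hG.isPGroup hM hA) (Ne.symm hne))
  -- The series is indexed from 0, so k = 2 is γ₃, nontrivial because n ≥ 4. If G₁ = G, then γ₃ ≤ γ₄
  -- and the series stalls there.
  refine hG.lowerCentralSeries_ne_bot (k := 2) (by omega)
    (lowerCentralSeries_eq_bot_of_succ_eq
      (le_antisymm (Subgroup.lowerCentralSeries_antitone _ (Nat.le_succ 2)) ?_))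
  rw [Subgroup.lowerCentralSeries_succ ⊤ 1, Subgroup.commutator_le]
  intro h hh g _
  exact (mem_G₁_iff g).mp (htop ▸ Subgroup.mem_top g) h hh

end Main

end Beauville

theorem corollary2p6 {p n : ℕ} (hp : p.Prime) {G : Type*} [Group G]
    (hG : Beauville.IsMaximalClass p n G) (hn : p + 1 ≤ n)
    (hA : ∃ M : Subgroup G, IsCoatom M ∧ IsMulCommutative M) :
    (Beauville.IsBeauville G ↔ 5 ≤ p ∧ ∀ g : G, g ∉ Beauville.G₁ G → orderOf g = p) ∧
    (Beauville.IsBeauville G → Beauville.IsTameType G) := by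
  obtain ⟨M, hM, hA⟩ := hA
  have := Fact.mk hp
  have := hG.finite hp
  have h2 := hp.two_le
  refine ⟨⟨?_, ?_⟩, hG.isTameType hp (by omega) hM hA⟩
  · rintro ⟨_, x₁, y₁, x₂, y₂, h⟩
    refine ⟨h.five_le hp hG (by omega) hM hA, fun g hg => ?_⟩
    -- Only M ≤ G₁ is needed here; equality would require n ≥ 4, which n ≥ p + 1 alone does not give
    -- when p = 2.
    refine orderOf_eq_prime (h.pow_eq_one hp hG (by omega) hM hA fun hgM =>
      hg (Beauville.le_G₁ hG.isPGroup hM hA hgM)) ?_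
    rintro rfl
    exact hg (one_mem _)
  · rintro ⟨hp5, hord⟩
    refine hG.isBeauville hp (by omega) hM hp5 fun v hv => ?_
    rw [← hG.G₁_eq hp (by omega) hM hA] at hv
    rw [← hord v hv]
    exact pow_orderOf_eq_one v
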